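/- Let $L$ be a skew field, let $V$ be a vector space of dimension $n+1$ over $L$, and call a subspace of $V$ of dimension $d+1$ a $d$-space. For integers $0\le i<j\le n-i-1$ let $\Gamma^n_{i,j;i}(L)$ be the bipartite graph whose two biparts are the set of $i$-spaces and the set of $j$-spaces, an $i$-space being adjacent to a $j$-space if and only if their intersection is an $i$-space, that is, if and only if the $i$-space is contained in the $j$-space. Then the following hold. (1) The graph determines $i$, $j$, $n$ and, up to passing to the opposite skew field when $i+j=n-1$, also $L$: if $L'$ is a skew field, $0\le i'<j'\le n'-i'-1$, and $\Gamma^n_{i,j;i}(L)\cong\Gamma^{n'}_{i',j';i'}(L')$ as abstract graphs, then $i=i'$, $j=j'$, $n=n'$, and either $L\cong L'$, or $i+j=n-1$ and $L$ is isomorphic to the opposite skew field of $L'$. (2) Every automorphism $\Phi$ of the graph $\Gamma^n_{i,j;i}(L)$ is induced by a semilinear permutation of $V$ or, in case $i+j=n-1$, possibly by a duality. That is, either there are an automorphism $\sigma$ of $L$ and a bijective $\sigma$-semilinear map $f:V\to V$ such that $\Phi(U)=f(U)$ for every vertex $U$; or $i+j=n-1$ and there are an isomorphism $\sigma$ from $L$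 to its opposite skew field and a bijective $\sigma$-semilinear map $f$ from $V$ to its dual space $V^*$ such that $\Phi(U)=\{v\in V: f(u)(v)=0\text{ for all }u\in U\}$ for every vertex $U$. -/

import Mathlib

open Module

/-- The `d`-spaces of the projective space `PG(n, L)` attached to a vector space `V` over the skew
field `L`: subspaces of projective dimension `d`, that is, of vector space dimension `d + 1`. -/
abbrev ProjSubspace (L V : Type*) [DivisionRing L] [AddCommGroup V] [Module L V] (d : ℕ) : Type _ :=
  {U : Submodule L V // finrank L U = d + 1}

/-- The vertices of the bipartite graphs of `i`-spaces and `j`-spaces: one bipart consists of the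
`i`-spaces and the other one of the `j`-spaces. -/
abbrev BipVertex (L V : Type*) [DivisionRing L] [AddCommGroup V] [Module L V] (i j : ℕ) : Type _ :=
  ProjSubspace L V i ⊕ ProjSubspace L V j

/-- The subspace of `V` that a vertex represents. -/
def BipVertex.space {L V : Type*} [DivisionRing L] [AddCommGroup V] [Module L V] {i j : ℕ} :
    BipVertex L V i j → Submodule L V :=
  Sum.elim Subtype.val Subtype.val

/-- The bipartite graph of `i`-spaces and `j`-spaces in which an `i`-space is adjacent to a
`j`-space if and only if they intersect in a `k`-space. For `k = i ≤ j` adjacency is containment. -/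
def bipGraph (L V : Type*) [DivisionRing L] [AddCommGroup V] [Module L V] (i j k : ℕ) :
    SimpleGraph (BipVertex L V i j) where
  Adj
    | Sum.inl U, Sum.inr W => finrank L (U.1 ⊓ W.1 : Submodule L V) = k + 1
    | Sum.inr W, Sum.inl U => finrank L (U.1 ⊓ W.1 : Submodule L V) = k + 1
    | _, _ => False
  symm := ⟨by rintro (U | U) (W | W) h <;> exact h⟩
  loopless := ⟨by rintro (U | U) h <;> exact h⟩

/-- A map `Φ` between vertices is induced by a semilinear permutation `f` of the underlying vector
space (with respect to an automorphism `σ` of the skew field): it sends every subspace `U` to its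
image `f U`. -/
def InducedBySemilinear {L V : Type*} [DivisionRing L] [AddCommGroup V] [Module L V] {i j : ℕ}
    (Φ : BipVertex L V i j → BipVertex L V i j) : Prop :=
  ∃ (σ : L ≃+* L) (f : V →ₛₗ[(σ : L →+* L)] V), Function.Bijective f ∧
    ∀ x, ((Φ x).space : Set V) = f '' (x.space : Set V)

/-- A map `Φ` between vertices is induced by a duality. The dual `V →ₗ[L] L` is a vector space over
the opposite skew field, by `(MulOpposite.op a • φ) v = φ v * a`. A semilinear bijection `f` from
`V` to its dual (with respect to an isomorphism `σ` from `L` to its opposite) gives the duality that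
sends a subspace `U` to the common zero set of the linear forms `f u`, for `u ∈ U`. -/
def InducedByDuality {L V : Type*} [DivisionRing L] [AddCommGroup V] [Module L V] {i j : ℕ}
    (Φ : BipVertex L V i j → BipVertex L V i j) : Prop :=
  ∃ (σ : L ≃+* Lᵐᵒᵖ) (f : V →ₛₗ[(σ : L →+* Lᵐᵒᵖ)] (V →ₗ[L] L)), Function.Bijective f ∧
    ∀ x, ((Φ x).space : Set V) = {v | ∀ u ∈ x.space, f u v = 0}

/-! The proof reduces a graph isomorphism to the fundamental theorem of projective geometry. The
graph is connected on its `i`-spaces, so an isomorphism either preserves or interchanges the two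
biparts (`bipGraph_iso_cases`).

If the biparts are preserved, there is a pair of bijections respecting incidence. A subspace of
dimension at most `j + 1` is the intersection of the `j`-spaces through it
(`ProjSubspace.le_iff_forall`), so incidence detects when two `i`-spaces are neighbours. Three
pairwise neighbours that do not lie in a common `(i + 1)`-space meet in an `(i - 1)`-space, so the
`(i - 1)`-spaces can be recovered together with their incidences. Repeating this leads down to the
points (`exists_points`). The number of descents is an invariant, since points are the only case
where any two distinct spaces are neighbours; hence `i = i'`. Lines are intersections of `j`-spaces,
so the bijection of points is a collineation. `IsCollineation.exists_semilinear` then supplies a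
semilinear bijection, which preserves dimensions and therefore yields `j = j'` and `n = n'`.

If the biparts are interchanged, incidence is reversed. Composing with annihilators in the dual
space restores it, and the first case applies with the opposite skew field (`exists_duality`). The
resulting dimension equations, combined with the bounds on `i + j` and `i' + j'`, leave only `i + j
= n - 1`. -/

open Submodule in
/-- The map `g` between vector spaces over skew fields induces a bijection between the points of
the projective spaces, which preserves collinearity in both directions. -/
structure IsCollineation (L : Type*) {V : Type*} (L' : Type*) {V' : Type*} [DivisionRing L]
    [AddCommGroup V] [Module L V] [DivisionRing L'] [AddCommGroup V'] [Module L' V']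
    (g : V → V') : Prop where
  map_zero : g 0 = 0
  map_mem_span_pair : ∀ x y z, g z ∈ span L' {g x, g y} ↔ z ∈ span L {x, y}
  surj : ∀ v, ∃ x, v ∈ span L' {g x}

/-! ### The fundamental theorem of projective geometry -/

section Collineation

variable {L V L' V' : Type*} [DivisionRing L] [AddCommGroup V] [Module L V]
  [DivisionRing L'] [AddCommGroup V'] [Module L' V']

open Submodule

theorem linearIndependent_pair_iff_notMem {x y : V} :
    LinearIndependent L ![x, y] ↔ x ≠ 0 ∧ y ∉ span L {x} := by
  rcases eq_or_ne x 0 with rfl | hx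
  · simp only [ne_eq, not_true_eq_false, false_and, iff_false]
    exact fun h => h.ne_zero 0 rfl
  · rw [LinearIndependent.pair_iff' hx, mem_span_singleton]
    simp [hx]

theorem eq_zero_of_notMem_span_pair {x y z : V} (h : LinearIndependent L ![x, y])
    (hz : z ∉ span L {x, y}) {a b c : L} (h0 : a • x + b • y + c • z = 0) :
    a = 0 ∧ b = 0 ∧ c = 0 := by
  have hc : c = 0 := by
    by_contra hc
    refine hz (mem_span_pair.2 ⟨-(c⁻¹ * a), -(c⁻¹ * b), ?_⟩)
    have : c • z = -(a • x + b • y) := by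
      rw [eq_neg_iff_add_eq_zero, add_comm]; exact h0
    have h2 : z = c⁻¹ • (c • z) := by rw [smul_smul, inv_mul_cancel₀ hc, one_smul]
    rw [h2, this]
    simp only [smul_add, mul_smul, neg_smul, smul_neg]; abel
  subst hc
  have := LinearIndependent.pair_iff.1 h a b (by simpa using h0)
  exact ⟨this.1, this.2, rfl⟩

theorem linearIndependent_of_notMem_left {x y z : V} (hx : x ≠ 0) (hz : z ∉ span L {x, y}) :
    LinearIndependent L ![x, z] :=
  linearIndependent_pair_iff_notMem.2 ⟨hx, fun h => hz (span_mono (by simp) h)⟩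

theorem linearIndependent_of_notMem_right {x y z : V} (hy : y ≠ 0) (hz : z ∉ span L {x, y}) :
    LinearIndependent L ![y, z] :=
  linearIndependent_pair_iff_notMem.2 ⟨hy, fun h => hz (span_mono (by simp) h)⟩

namespace IsCollineation

variable {g : V → V'}

/-- Only the points spanned by the values of `g` matter, so each value may be replaced by any
representative of its point. The rest of the section exploits this freedom to rescale until the map
becomes additive. -/
theorem mem_iff (hg : IsCollineation L L' g) {x y z : V} {x' y' z' : V'}
    (hx : span L' {x'} = span L' {g x}) (hy : span L' {y'} = span L' {g y})
    (hz : span L' {z'} = span L' {g z}) : z' ∈ span L' {x', y'} ↔ z ∈ span L {x, y} := by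
  rw [← hg.map_mem_span_pair, ← span_singleton_le_iff_mem, ← span_singleton_le_iff_mem, hz,
    span_insert, span_insert, hx, hy]

theorem mem_iff_singleton (hg : IsCollineation L L' g) {x z : V} {x' z' : V'}
    (hx : span L' {x'} = span L' {g x}) (hz : span L' {z'} = span L' {g z}) :
    z' ∈ span L' {x'} ↔ z ∈ span L {x} := by
  simpa using hg.mem_iff hx hx hz

theorem eq_zero_iff (hg : IsCollineation L L' g) {x : V} {x' : V'}
    (hx : span L' {x'} = span L' {g x}) : x' = 0 ↔ x = 0 := by
  simpa using hg.mem_iff_singleton (x := 0) (x' := 0) (by simp [hg.map_zero]) hx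

theorem linearIndependent (hg : IsCollineation L L' g) {x y : V} {x' y' : V'}
    (hx : span L' {x'} = span L' {g x}) (hy : span L' {y'} = span L' {g y})
    (h : LinearIndependent L ![x, y]) : LinearIndependent L' ![x', y'] := by
  rw [linearIndependent_pair_iff_notMem] at h ⊢
  rwa [hg.mem_iff_singleton hx hy, ne_eq, hg.eq_zero_iff hx]

theorem span_eq_of_smul (hg : IsCollineation L L' g) {t : V} (ht : t ≠ 0) {v : V'} {a : L'}
    (h : a • v = g t) : span L' {v} = span L' {g t} := by
  have ha : a ≠ 0 := by
    rintro rfl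
    exact ht ((hg.eq_zero_iff rfl).1 (by simpa using h.symm))
  rw [← h, span_singleton_smul_eq (IsUnit.mk0 a ha)]

/-- The point of `g (x + y)` lies on the line through `x'` and `g y` but equals neither of these
points. Both coefficients are therefore nonzero, and `g y` can be rescaled to make them equal. -/
theorem exists_add (hg : IsCollineation L L' g) {x y : V} {x' : V'}
    (h : LinearIndependent L ![x, y]) (hx : span L' {x'} = span L' {g x}) :
    ∃ y', span L' {y'} = span L' {g y} ∧ span L' {x' + y'} = span L' {g (x + y)} := by
  have hI := LinearIndependent.pair_iff.1 h
  obtain ⟨a, b, hab⟩ := mem_span_pair.1 ((hg.mem_iff hx rfl rfl).2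
    (mem_span_pair.2 ⟨1, 1, by simp⟩) : g (x + y) ∈ span L' {x', g y})
  have hxy : x + y ≠ 0 := fun h0 => one_ne_zero (hI 1 1 (by simpa using h0)).1
  have ha : a ≠ 0 := by
    rintro rfl
    have : x + y ∈ span L {y} := (hg.mem_iff_singleton rfl rfl).1
      (mem_span_singleton.2 ⟨b, by simpa using hab⟩)
    obtain ⟨c, hc⟩ := mem_span_singleton.1 this
    refine one_ne_zero (hI 1 (1 - c) ?_).1
    rw [sub_smul, hc]; simp only [one_smul]; abel
  have hb : b ≠ 0 := by
    rintro rfl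
    have : x + y ∈ span L {x} := (hg.mem_iff_singleton hx rfl).1
      (mem_span_singleton.2 ⟨a, by simpa using hab⟩)
    obtain ⟨c, hc⟩ := mem_span_singleton.1 this
    refine one_ne_zero (hI (1 - c) 1 ?_).2
    rw [sub_smul, hc]; simp only [one_smul]; abel
  refine ⟨(a⁻¹ * b) • g y, span_singleton_smul_eq
    (IsUnit.mk0 _ (mul_ne_zero (inv_ne_zero ha) hb)) _, hg.span_eq_of_smul hxy (a := a) ?_⟩
  rw [← hab, smul_add, smul_smul, mul_inv_cancel_left₀ ha]

theorem add_unique (hg : IsCollineation L L' g) {x y : V} {x' y' z' : V'}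
    (h : LinearIndependent L ![x, y]) (hx : span L' {x'} = span L' {g x})
    (hy : span L' {y'} = span L' {g y}) (hz : span L' {z'} = span L' {g y})
    (hxy : span L' {x' + y'} = span L' {g (x + y)})
    (hxz : span L' {x' + z'} = span L' {g (x + y)}) : y' = z' := by
  have hI := LinearIndependent.pair_iff.1 (hg.linearIndependent hx hy h)
  obtain ⟨c, rfl⟩ := mem_span_singleton.1 ((hz.trans hy.symm).le (mem_span_singleton_self z'))
  obtain ⟨d, hd⟩ := mem_span_singleton.1 ((hxz.trans hxy.symm).le (mem_span_singleton_self _))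
  obtain ⟨h1, h2⟩ := hI (d - 1) (d - c) (by
    have : (d - 1) • x' + (d - c) • y' = d • (x' + y') - (x' + c • y') := by
          simp only [smul_add, sub_smul, one_smul]; abel
    rw [this, hd, sub_self])
  rw [← sub_eq_zero.1 h2, sub_eq_zero.1 h1, one_smul]

/-- Each new point is an intersection of two lines: `x + y + z` of the lines through `x + y, z` and
`x + z, y`, and `y + z` of the lines through `y, z` and `x, x + y + z`. Comparing coefficients in
the images gives the representatives. -/
theorem add_three (hg : IsCollineation L L' g) {x y z : V} {x' y' z' : V'}
    (h : LinearIndependent L ![x, y]) (hz0 : z ∉ span L {x, y})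
    (hx : span L' {x'} = span L' {g x})
    (hy : span L' {y'} = span L' {g y}) (hz : span L' {z'} = span L' {g z})
    (hxy : span L' {x' + y'} = span L' {g (x + y)})
    (hxz : span L' {x' + z'} = span L' {g (x + z)}) :
    span L' {x' + y' + z'} = span L' {g (x + y + z)} ∧
      span L' {y' + z'} = span L' {g (y + z)} := by
  have hI := hg.linearIndependent hx hy h
  have hz1 : z' ∉ span L' {x', y'} := by rwa [hg.mem_iff hx hy hz]
  have key : ∀ {a b c : L'}, a • x' + b • y' + c • z' = 0 → a = 0 ∧ b = 0 ∧ c = 0 :=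
    fun h => eq_zero_of_notMem_span_pair hI hz1 h
  have hne : x + y + z ≠ 0 := fun h0 => one_ne_zero
    (eq_zero_of_notMem_span_pair h hz0 (a := 1) (b := 1) (c := 1) (by simpa using h0)).1
  have hne2 : y + z ≠ 0 := fun h0 => one_ne_zero
    (eq_zero_of_notMem_span_pair h hz0 (a := 0) (b := 1) (c := 1) (by simpa using h0)).2.1
  have h1 : span L' {x' + y' + z'} = span L' {g (x + y + z)} := by
    obtain ⟨a, b, hab⟩ := mem_span_pair.1 ((hg.mem_iff hxy hz rfl).2
      (mem_span_pair.2 ⟨1, 1, by simp⟩) : g (x + y + z) ∈ span L' {x' + y', z'})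
    obtain ⟨c, d, hcd⟩ := mem_span_pair.1 ((hg.mem_iff hxz hy rfl).2
      (mem_span_pair.2 ⟨1, 1, by simp only [one_smul]; abel⟩) :
        g (x + y + z) ∈ span L' {x' + z', y'})
    obtain ⟨e1, e2, e3⟩ := key (a := a - c) (b := a - d) (c := b - c) (by
      have : (a - c) • x' + (a - d) • y' + (b - c) • z' =
        (a • (x' + y') + b • z') - (c • (x' + z') + d • y') := by
          simp only [smul_add, sub_smul]; abel
      rw [this, hab, hcd, sub_self])
    refine hg.span_eq_of_smul hne (a := a) ?_
    rw [← hab, sub_eq_zero.1 e3, ← sub_eq_zero.1 e1, smul_add]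
  refine ⟨h1, ?_⟩
  obtain ⟨a, b, hab⟩ := mem_span_pair.1 ((hg.mem_iff hy hz rfl).2
      (mem_span_pair.2 ⟨1, 1, by simp⟩) : g (y + z) ∈ span L' {y', z'})
  obtain ⟨c, d, hcd⟩ := mem_span_pair.1 ((hg.mem_iff hx h1 rfl).2
      (mem_span_pair.2 ⟨-1, 1, by simp only [smul_add, neg_smul, one_smul]; abel⟩) :
        g (y + z) ∈ span L' {x', x' + y' + z'})
  obtain ⟨e1, e2, e3⟩ := key (a := c + d) (b := d - a) (c := d - b) (by
      have : (c + d) • x' + (d - a) • y' + (d - b) • z' =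
        (c • x' + d • (x' + y' + z')) - (a • y' + b • z') := by
          simp only [smul_add, add_smul, sub_smul]; abel
      rw [this, hab, hcd, sub_self])
  refine hg.span_eq_of_smul hne2 (a := a) ?_
  rw [← hab, ← sub_eq_zero.1 e3, ← sub_eq_zero.1 e2, smul_add]

/-- Compatibility of representatives with addition passes from `x, y` and `x, z` to `y, z`. If the
three vectors are coplanar, an auxiliary `w` outside their plane is matched with `y` and with `z`,
and `w` then takes over the role of `x`. -/
theorem add_trans (hg : IsCollineation L L' g) (hd : ∀ x y : V, ∃ z, z ∉ span L {x, y})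
    {x y z : V} {x' y' z' : V'}
    (hIxy : LinearIndependent L ![x, y]) (hIxz : LinearIndependent L ![x, z])
    (hIyz : LinearIndependent L ![y, z]) (hx : span L' {x'} = span L' {g x})
    (hy : span L' {y'} = span L' {g y}) (hz : span L' {z'} = span L' {g z})
    (hxy : span L' {x' + y'} = span L' {g (x + y)})
    (hxz : span L' {x' + z'} = span L' {g (x + z)}) :
    span L' {y' + z'} = span L' {g (y + z)} := by
  by_cases hz0 : z ∈ span L {x, y}
  · obtain ⟨w, hw⟩ := hd x y
    have hx0 : x ≠ 0 := hIxy.ne_zero 0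
    have hy0 : y ≠ 0 := hIxy.ne_zero 1
    have hIxw := linearIndependent_of_notMem_left hx0 hw
    have hIyw := linearIndependent_of_notMem_right hy0 hw
    obtain ⟨w', hw1, hw2⟩ := hg.exists_add hIxw hx
    have hyw := (hg.add_three hIxy hw hx hy hw1 hxy hw2).2
    have hw3 : w ∉ span L {x, z} := fun h => hw (span_le.2 (by
      rintro _ (rfl | rfl)
      exacts [subset_span (by simp), hz0]) h)
    have hw4 : w ∉ span L {y, z} := fun h => hw (span_le.2 (by
      rintro _ (rfl | rfl)
      exacts [subset_span (by simp), hz0]) h)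
    have hzw := (hg.add_three hIxz hw3 hx hz hw1 hxz hw2).2
    have hIwy := LinearIndependent.pair_symm_iff.1 hIyw
    refine (hg.add_three hIwy (z := z) ?_ hw1 hy hz (by rwa [add_comm w', add_comm w])
      (by rwa [add_comm w', add_comm w])).2
    intro h
    obtain ⟨a, b, hab⟩ := mem_span_pair.1 h
    have := eq_zero_of_notMem_span_pair hIyz hw4 (a := b) (b := -1) (c := a)
      (by rw [← hab]; simp only [smul_add, neg_smul, one_smul]; abel)
    simpa using this.2.1
  · exact (hg.add_three hIxy hz0 hx hy hz hxy hxz).2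

theorem exists_quasiadditive (hg : IsCollineation L L' g)
    (hd : ∀ x y : V, ∃ z, z ∉ span L {x, y}) :
    ∃ f : V → V', (∀ x, span L' {f x} = span L' {g x}) ∧
      ∀ x y, LinearIndependent L ![x, y] → span L' {f x + f y} = span L' {g (x + y)} := by
  have hsymm : ∀ {x y : V} {x' y' : V'}, span L' {x' + y'} = span L' {g (x + y)} →
      span L' {y' + x'} = span L' {g (y + x)} := fun {x y x' y'} h => by
    rwa [add_comm y', add_comm y]
  have hI : ∀ {x y : V}, LinearIndependent L ![x, y] → LinearIndependent L ![y, x] :=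
    fun h => LinearIndependent.pair_symm_iff.1 h
  have hdep : ∀ {x y : V}, x ≠ 0 → ¬ LinearIndependent L ![x, y] →
      ∃ a : L, a • x = y := by
    intro x y hx h
    rw [linearIndependent_pair_iff_notMem] at h
    exact mem_span_singleton.1 (by tauto)
  have hsmul : ∀ {x y : V} {a : L}, a • x ≠ 0 → LinearIndependent L ![x, y] →
      LinearIndependent L ![a • x, y] := by
    intro x y a ha h
    refine hI (linearIndependent_pair_iff_notMem.2 ⟨h.ne_zero 1, fun hm => ?_⟩)
    have ha0 : a ≠ 0 := by rintro rfl; simp at ha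
    rw [smul_mem_iff _ ha0] at hm
    exact (linearIndependent_pair_iff_notMem.1 (hI h)).2 hm
  obtain ⟨e, he⟩ := hd 0 0
  replace he : e ≠ 0 := by simpa using he
  obtain ⟨w, hw⟩ := hd e e
  have hew : LinearIndependent L ![e, w] := linearIndependent_of_notMem_left he hw
  have hw0 : w ≠ 0 := hew.ne_zero 1
  obtain ⟨w', hw', hew'⟩ := hg.exists_add hew rfl
  -- Representatives are normalised against `e`. This is impossible on multiples of `e`, so a second
  -- reference vector `w`, itself normalised against `e`, serves there; `add_trans` makes both
  -- normalisations agree.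
  have hex : ∀ x, ∃ x', span L' {x'} = span L' {g x} ∧
      (LinearIndependent L ![e, x] → span L' {g e + x'} = span L' {g (e + x)}) ∧
      (LinearIndependent L ![w, x] → span L' {w' + x'} = span L' {g (w + x)}) := by
    intro x
    by_cases hex : LinearIndependent L ![e, x]
    · obtain ⟨x', h1, h2⟩ := hg.exists_add hex rfl
      exact ⟨x', h1, fun _ => h2, fun h => hg.add_trans hd hew hex h rfl hw' h1 hew' h2⟩
    · by_cases hwx : LinearIndependent L ![w, x]
      · obtain ⟨x', h1, h2⟩ := hg.exists_add hwx hw'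
        exact ⟨x', h1, fun h => absurd h hex, fun h => h2⟩
      · exact ⟨g x, rfl, fun h => absurd h hex, fun h => absurd h hwx⟩
  choose f hf hfe hfw using hex
  refine ⟨f, hf, ?_⟩
  have main : ∀ x y : V, LinearIndependent L ![x, y] → ¬ LinearIndependent L ![e, x] →
      span L' {f x + f y} = span L' {g (x + y)} := by
    intro x y hxy hex
    obtain ⟨a, rfl⟩ := hdep he hex
    have hx0 : a • e ≠ 0 := hxy.ne_zero 0
    have hwx : LinearIndependent L ![w, a • e] := hI (hsmul hx0 hew)
    by_cases hwy : LinearIndependent L ![w, y]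
    · exact hg.add_trans hd hwx hwy hxy hw' (hf _) (hf _) (hfw _ hwx) (hfw _ hwy)
    · obtain ⟨b, rfl⟩ := hdep hw0 hwy
      have hy0 : b • w ≠ 0 := hxy.ne_zero 1
      have hey : LinearIndependent L ![e, b • w] := hI (hsmul hy0 (hI hew))
      -- Here `x` is a multiple of `e` and `y` one of `w`, so neither reference vector can be
      -- compared with both. A third direction `z` links them.
      obtain ⟨z, hz⟩ := hd e w
      have hez := linearIndependent_of_notMem_left he hz
      have hwz := linearIndependent_of_notMem_right hw0 hz
      have hxz := hsmul hx0 hez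
      have hyz := hsmul hy0 hwz
      exact hg.add_trans hd (hI hxz) (hI hyz) hxy (hf z) (hf _) (hf _)
        (hsymm (hg.add_trans hd hwx hwz hxz hw' (hf _) (hf _) (hfw _ hwx) (hfw _ hwz)))
        (hsymm (hg.add_trans hd hey hez hyz rfl (hf _) (hf _) (hfe _ hey) (hfe _ hez)))
  intro x y hxy
  by_cases hex : LinearIndependent L ![e, x]
  · by_cases hey : LinearIndependent L ![e, y]
    · exact hg.add_trans hd hex hey hxy rfl (hf _) (hf _) (hfe _ hex) (hfe _ hey)
    · exact hsymm (main y x (hI hxy) hey)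
  · exact main x y hxy hex

theorem exists_additive (hg : IsCollineation L L' g)
    (hd : ∀ x y : V, ∃ z, z ∉ span L {x, y}) :
    ∃ f : V →+ V', ∀ x, span L' {f x} = span L' {g x} := by
  obtain ⟨f, hf, hfadd⟩ := hg.exists_quasiadditive hd
  have hf0 : f 0 = 0 := (hg.eq_zero_iff (hf 0)).2 rfl
  have hI : ∀ {x y : V}, LinearIndependent L ![x, y] → LinearIndependent L ![y, x] :=
    fun h => LinearIndependent.pair_symm_iff.1 h
  have hadd : ∀ x y, LinearIndependent L ![x, y] → f (x + y) = f x + f y := by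
    intro x y hxy
    obtain ⟨z, hz⟩ := hd x y
    have hzx := hI (linearIndependent_of_notMem_left (hxy.ne_zero 0) hz)
    have hzy := hI (linearIndependent_of_notMem_right (hxy.ne_zero 1) hz)
    have hxyne : x + y ≠ 0 := fun h0 => one_ne_zero
      (LinearIndependent.pair_iff.1 hxy 1 1 (by simpa using h0)).1
    have hzxy : LinearIndependent L ![z, x + y] := hI (linearIndependent_pair_iff_notMem.2
      ⟨hxyne, fun h => hz (span_singleton_le_iff_mem _ _ |>.2
        (mem_span_pair.2 ⟨1, 1, by simp⟩) h)⟩)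
    -- Both `f (x + y)` and `f x + f y` represent the same point, and adding `f z` to either
    -- represents `g (z + x + y)`; uniqueness of the scaling makes them equal.
    refine hg.add_unique hzxy (hf z) (hf _) (hfadd _ _ hxy) (hfadd _ _ hzxy) ?_
    have hy : y ∉ span L {z, x} := by
      intro h
      obtain ⟨a, b, hab⟩ := mem_span_pair.1 h
      have := eq_zero_of_notMem_span_pair hxy hz (a := b) (b := -1) (c := a)
        (by rw [← hab]; simp only [smul_add, neg_smul, one_smul]; abel)
      simpa using this.2.1
    rw [← add_assoc, ← add_assoc]
    exact (hg.add_three hzx hy (hf z) (hf x) (hf y) (hfadd _ _ hzx) (hfadd _ _ hzy)).1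
  refine ⟨⟨⟨f, hf0⟩, fun x y => ?_⟩, hf⟩
  change f (x + y) = f x + f y
  by_cases hxy : LinearIndependent L ![x, y]
  · exact hadd x y hxy
  rcases eq_or_ne x 0 with rfl | hx
  · simp [hf0]
  rcases eq_or_ne y 0 with rfl | hy
  · simp [hf0]
  obtain ⟨a, rfl⟩ : ∃ a : L, a • x = y := by
    rw [linearIndependent_pair_iff_notMem] at hxy
    exact mem_span_singleton.1 (by tauto)
  obtain ⟨z, hz⟩ := hd x x
  have hxz := linearIndependent_of_notMem_left hx hz
  have hI' := LinearIndependent.pair_iff.1 hxz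
  have ha : a ≠ 0 := by rintro rfl; simp at hy
  have h1 : LinearIndependent L ![a • x, z] := LinearIndependent.pair_iff.2 fun s t h => by
    have := hI' (s * a) t (by rwa [mul_smul])
    exact ⟨by simpa [ha] using this.1, this.2⟩
  have h2 : LinearIndependent L ![x, a • x + z] := LinearIndependent.pair_iff.2 fun s t h => by
    have := hI' (s + t * a) t (by rw [← h]; simp only [smul_add, add_smul, mul_smul]; abel)
    obtain ⟨h3, rfl⟩ := this
    exact ⟨by simpa using h3, rfl⟩
  -- For dependent vectors, the value at `x + a • x + z` is expanded through independent pairs in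
  -- two ways, and `f z` cancels.
  have h4 : f (x + a • x + z) = f x + f (a • x) + f z := by
    rw [add_assoc, hadd _ _ h2, hadd _ _ h1, add_assoc]
  rcases eq_or_ne (x + a • x) 0 with h0 | h0
  · rw [h0, zero_add] at h4
    rw [h0, hf0]
    exact (by simpa using h4 : _ = (0 : V')).symm
  · have h5 : LinearIndependent L ![x + a • x, z] := by
      have hb : 1 + a ≠ 0 := by
        intro hb; apply h0
        rw [show x + a • x = (1 + a) • x by simp only [add_smul, one_smul], hb, zero_smul]
      refine LinearIndependent.pair_iff.2 fun s t h => ?_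
      have := hI' (s * (1 + a)) t (by
        rw [← h]; simp only [smul_add, add_smul, mul_smul, one_smul])
      exact ⟨by simpa [hb] using this.1, this.2⟩
    rw [hadd _ _ h5] at h4
    exact add_right_cancel h4

/-- The fundamental theorem of projective geometry. -/
theorem exists_semilinear (hg : IsCollineation L L' g)
    (hd : ∀ x y : V, ∃ z, z ∉ span L {x, y}) :
    ∃ (σ : L ≃+* L') (f : V →ₛₗ[(σ : L →+* L')] V'), Function.Bijective f ∧
      ∀ x, span L' {f x} = span L' {g x} := by
  obtain ⟨f, hf⟩ := hg.exists_additive hd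
  have hf0 : ∀ {x}, f x = 0 ↔ x = 0 := fun {x} => hg.eq_zero_iff (hf x)
  obtain ⟨e, he⟩ := hd 0 0
  replace he : e ≠ 0 := by simpa using he
  have hsm : ∀ (a : L) (x : V), ∃ b : L', b • f x = f (a • x) := fun a x =>
    mem_span_singleton.1 ((hg.mem_iff_singleton (hf x) (hf (a • x))).2
      (mem_span_singleton.2 ⟨a, rfl⟩))
  have huniq : ∀ {a b : L'} {x : V}, x ≠ 0 → a • f x = b • f x → a = b := fun hx h =>
    smul_left_injective L' (mt hf0.1 hx) h
  choose s hs using fun a => hsm a e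
  have hsx : ∀ a x, LinearIndependent L ![e, x] → f (a • x) = s a • f x := by
    intro a x h
    obtain ⟨b, hb⟩ := hsm a x
    obtain ⟨c, hc⟩ := hsm a (e + x)
    rw [smul_add, map_add, map_add, ← hs, ← hb] at hc
    obtain ⟨h1, h2⟩ := LinearIndependent.pair_iff.1
      (hg.linearIndependent (hf e) (hf x) h) (c - s a) (c - b) (by
        have : (c - s a) • f e + (c - b) • f x = c • (f e + f x) - (s a • f e + b • f x) := by
          simp only [smul_add, sub_smul]; abel
        rw [this, hc, sub_self])
    rw [← hb, ← sub_eq_zero.1 h2, sub_eq_zero.1 h1]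
  obtain ⟨w, hw⟩ := hd e e
  have hew : LinearIndependent L ![e, w] := linearIndependent_of_notMem_left he hw
  have hsmul : ∀ a x, f (a • x) = s a • f x := by
    intro a x
    by_cases h : LinearIndependent L ![e, x]
    · exact hsx a x h
    · have h1 : LinearIndependent L ![e, x + w] := by
        refine linearIndependent_pair_iff_notMem.2 ⟨he, fun hm => ?_⟩
        rw [linearIndependent_pair_iff_notMem] at h hew
        have hx : x ∈ span L {e} := by tauto
        exact hew.2 ((add_mem_cancel_left hx).1 hm)
      have h2 := hsx a _ h1
      rw [smul_add, map_add, map_add, hsx a w hew, smul_add] at h2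
      exact add_right_cancel h2
  let σ : L →+* L' :=
    { toFun := s
      map_one' := huniq he (by rw [← hsmul]; simp)
      map_mul' := fun a b => huniq he (by rw [mul_smul, ← hsmul, ← hsmul, ← hsmul, mul_smul])
      map_zero' := huniq he (by rw [← hsmul]; simp)
      map_add' := fun a b => huniq he (by
        rw [add_smul, ← hsmul, ← hsmul, ← hsmul, add_smul, map_add]) }
  have hσ : Function.Bijective σ := by
    refine ⟨σ.injective, fun c => ?_⟩
    -- Surjectivity of `σ`: the point of `c • f e + f w` comes from some `r = a • e + b • w`, and
    -- the ratio of coefficients gives `c = σ (b⁻¹ * a)`.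
    obtain ⟨r, hr⟩ := hg.surj (c • f e + f w)
    rw [← hf r] at hr
    have hne : c • f e + f w ≠ 0 := fun h0 => one_ne_zero (LinearIndependent.pair_iff.1
      (hg.linearIndependent (hf e) (hf w) hew) c 1 (by simpa using h0)).2
    obtain ⟨d, hd'⟩ := mem_span_singleton.1 hr
    have hd0 : d ≠ 0 := by
      rintro rfl
      exact hne (by simpa using hd'.symm)
    have hr2 : f r = d⁻¹ • (c • f e + f w) := by rw [← hd', inv_smul_smul₀ hd0]
    have hmem : r ∈ span L {e, w} := (hg.mem_iff (hf e) (hf w) (hf r)).1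
      (mem_span_pair.2 ⟨d⁻¹ * c, d⁻¹, by rw [hr2]; simp only [smul_add, mul_smul]⟩)
    obtain ⟨a, b, rfl⟩ := mem_span_pair.1 hmem
    rw [map_add, hsmul, hsmul] at hd'
    obtain ⟨h1, h2⟩ := LinearIndependent.pair_iff.1
      (hg.linearIndependent (hf e) (hf w) hew) (d * s a - c) (d * s b - 1) (by
        have : (d * s a - c) • f e + (d * s b - 1) • f w =
          d • (s a • f e + s b • f w) - (c • f e + f w) := by
          simp only [smul_add, sub_smul, mul_smul, one_smul]; abel
        rw [this, hd', sub_self])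
    have hsb : d = (s b)⁻¹ := eq_inv_of_mul_eq_one_left (sub_eq_zero.1 h2)
    refine ⟨b⁻¹ * a, ?_⟩
    rw [map_mul, map_inv₀]
    change (s b)⁻¹ * s a = c
    rw [← hsb, sub_eq_zero.1 h1]
  refine ⟨RingEquiv.ofBijective σ hσ, ⟨f.toAddHom, hsmul⟩, ⟨?_, ?_⟩, hf⟩
  · exact (injective_iff_map_eq_zero f).2 fun x => hf0.1
  · intro v
    obtain ⟨x, hx⟩ := hg.surj v
    rw [← hf x] at hx
    obtain ⟨c, hc⟩ := mem_span_singleton.1 hx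
    obtain ⟨a, rfl⟩ := hσ.2 c
    exact ⟨a • x, (hsmul a x).trans hc⟩

end IsCollineation

end Collineation

/-! ### Neighbouring subspaces in terms of incidence -/

section Dimension

variable {L V : Type*} [DivisionRing L] [AddCommGroup V] [Module L V]

namespace Submodule

variable [FiniteDimensional L V]

theorem exists_finrank_eq_between {W H : Submodule L V} (hWH : W ≤ H) {k : ℕ}
    (hk : finrank L W ≤ k) (hk' : k ≤ finrank L H) :
    ∃ B : Submodule L V, W ≤ B ∧ B ≤ H ∧ finrank L B = k := by
  induction k, hk using Nat.le_induction with
  | base => exact ⟨W, le_rfl, hWH, rfl⟩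
  | succ k hk ih =>
    obtain ⟨B, h1, h2, h3⟩ := ih (by omega)
    obtain ⟨x, hx, hxB⟩ : ∃ x ∈ H, x ∉ B := SetLike.not_le_iff_exists.1 fun h => by
      have := finrank_mono (R := L) h
      omega
    refine ⟨B ⊔ span L {x}, h1.trans le_sup_left, sup_le h2 (by simpa using hx), ?_⟩
    rw [finrank_sup_span_singleton hxB, h3]

/-- A linear form vanishing on `W` but not at `x` has a kernel of codimension at most one, inside
which `W` can be enlarged. -/
theorem exists_finrank_eq_notMem {W : Submodule L V} {x : V} (hx : x ∉ W) {k : ℕ}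
    (hk : finrank L W ≤ k) (hk' : k < finrank L V) :
    ∃ B : Submodule L V, W ≤ B ∧ x ∉ B ∧ finrank L B = k := by
  obtain ⟨f, hf, hW⟩ := exists_le_ker_of_notMem hx
  have h1 := LinearMap.finrank_range_add_finrank_ker f
  have h2 := finrank_le (LinearMap.range f)
  rw [finrank_self] at h2
  obtain ⟨B, h3, h4, h5⟩ := exists_finrank_eq_between hW hk (by omega)
  exact ⟨B, h3, fun h => hf (h4 h), h5⟩

omit [FiniteDimensional L V] in
theorem exists_notMem_of_finrank_lt {W : Submodule L V} (h : finrank L W < finrank L V) :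
    ∃ x, x ∉ W := by
  by_contra! hW
  rw [(eq_top_iff' (p := W)).2 hW, finrank_top] at h
  exact lt_irrefl _ h

end Submodule

namespace ProjSubspace

open Submodule

variable [FiniteDimensional L V] {i j : ℕ}

theorem eq_of_le {A A' : ProjSubspace L V i} (h : A.1 ≤ A'.1) : A = A' :=
  Subtype.ext (eq_of_le_of_finrank_le h (by rw [A.2, A'.2]))

theorem le_iff_forall {W : Submodule L V} (hW : finrank L W ≤ j + 1)
    (hj : j + 1 < finrank L V) {X : Submodule L V} :
    X ≤ W ↔ ∀ B : ProjSubspace L V j, W ≤ B.1 → X ≤ B.1 := by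
  refine ⟨fun h B hB => h.trans hB, fun h x hx => ?_⟩
  by_contra hxW
  obtain ⟨B, h1, h2, h3⟩ := exists_finrank_eq_notMem hxW hW hj
  exact h2 (h ⟨B, h3⟩ h1 hx)

theorem exists_ge {W : Submodule L V} (hW : finrank L W ≤ j + 1) (hj : j + 1 ≤ finrank L V) :
    ∃ B : ProjSubspace L V j, W ≤ B.1 := by
  obtain ⟨B, h1, -, h3⟩ := exists_finrank_eq_between (le_top : W ≤ ⊤) hW (by simpa)
  exact ⟨⟨B, h3⟩, h1⟩

theorem le_iff_exists {k : ℕ} (hij : i ≤ j) (hjk : j ≤ k) {A : ProjSubspace L V i}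
    {B : ProjSubspace L V k} : A.1 ≤ B.1 ↔ ∃ C : ProjSubspace L V j, A.1 ≤ C.1 ∧ C.1 ≤ B.1 := by
  refine ⟨fun h => ?_, fun ⟨C, h1, h2⟩ => h1.trans h2⟩
  obtain ⟨C, h1, h2, h3⟩ := exists_finrank_eq_between h (k := j + 1)
    (by rw [A.2]; omega) (by rw [B.2]; omega)
  exact ⟨⟨C, h3⟩, h1, h2⟩

/-- Two `i`-spaces are neighbours if they span an `(i + 1)`-space. -/
def Neighbour (A A' : ProjSubspace L V i) : Prop :=
  finrank L (A.1 ⊔ A'.1 : Submodule L V) = i + 2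

omit [FiniteDimensional L V] in
theorem Neighbour.ne {A A' : ProjSubspace L V i} (h : A.Neighbour A') : A ≠ A' := by
  rintro rfl
  rw [Neighbour, sup_idem, A.2] at h
  omega

theorem lt_finrank_sup {A A' : ProjSubspace L V i} (h : A ≠ A') :
    i + 2 ≤ finrank L (A.1 ⊔ A'.1 : Submodule L V) := by
  by_contra hlt
  refine h (eq_of_le ?_).symm
  have : A.1 = A.1 ⊔ A'.1 := eq_of_le_of_finrank_le le_sup_left (by rw [A.2]; omega)
  rw [this]
  exact le_sup_right

theorem finrank_sup_add_finrank_inf (A A' : ProjSubspace L V i) :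
    finrank L (A.1 ⊔ A'.1 : Submodule L V) + finrank L (A.1 ⊓ A'.1 : Submodule L V) =
      2 * i + 2 := by
  rw [finrank_sup_add_finrank_inf_eq, A.2, A'.2]
  ring

theorem neighbour_iff_finrank_inf {A A' : ProjSubspace L V i} :
    A.Neighbour A' ↔ finrank L (A.1 ⊓ A'.1 : Submodule L V) = i := by
  have := finrank_sup_add_finrank_inf A A'
  rw [Neighbour]
  omega

/-- One step from `A` towards `A'`: replace `A` by a hyperplane of `A` containing `A ⊓ A'`, extended
by a vector of `A'` outside `A`. -/
theorem exists_neighbour_le_sup {A A' : ProjSubspace L V i} (h : A ≠ A') :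
    ∃ X : ProjSubspace L V i, A.1 ⊓ A'.1 < X.1 ⊓ A'.1 ∧ X.1 ≤ A.1 ⊔ A'.1 ∧ A.Neighbour X := by
  obtain ⟨x, hx, hxA⟩ : ∃ x ∈ A'.1, x ∉ A.1 :=
    SetLike.not_le_iff_exists.1 fun hle => h (eq_of_le hle).symm
  have hinf : finrank L (A.1 ⊓ A'.1 : Submodule L V) ≤ i := by
    have := lt_finrank_sup h
    have := finrank_sup_add_finrank_inf A A'
    omega
  obtain ⟨H, h1, h2, h3⟩ := exists_finrank_eq_between (inf_le_left : A.1 ⊓ A'.1 ≤ A.1) hinf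
    (by rw [A.2]; omega)
  have hxH : x ∉ H := fun hm => hxA (h2 hm)
  refine ⟨⟨H ⊔ span L {x}, by rw [finrank_sup_span_singleton hxH, h3]⟩, ?_, ?_, ?_⟩
  · refine lt_of_le_not_ge (le_inf (h1.trans le_sup_left) inf_le_right) fun hle => hxA ?_
    exact (hle ⟨mem_sup_right (mem_span_singleton_self x), hx⟩).1
  · exact sup_le (h2.trans le_sup_left) (by simpa using mem_sup_right hx)
  · rw [Neighbour, ← sup_assoc, sup_eq_left.2 h2, finrank_sup_span_singleton hxA, A.2]

/-- The right-hand side uses incidence alone. Its last clause says that every `X ≠ A` in the span of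
`A` and `A'` already generates that span together with `A`. The step towards `A'` given by
`exists_neighbour_le_sup` tests this. -/
theorem neighbour_iff (hij : i < j) (hj : j + 1 < finrank L V) {A A' : ProjSubspace L V i} :
    A.Neighbour A' ↔ A ≠ A' ∧ (∃ B : ProjSubspace L V j, A.1 ≤ B.1 ∧ A'.1 ≤ B.1) ∧
      ∀ X : ProjSubspace L V i, X ≠ A →
        (∀ B : ProjSubspace L V j, A.1 ≤ B.1 → A'.1 ≤ B.1 → X.1 ≤ B.1) →
        ∀ B : ProjSubspace L V j, A.1 ≤ B.1 → X.1 ≤ B.1 → A'.1 ≤ B.1 := by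
  constructor
  · intro h
    have hle : finrank L (A.1 ⊔ A'.1 : Submodule L V) ≤ j + 1 := by rw [h]; omega
    refine ⟨h.ne, ?_, fun X hX hXB B hA hXB' => ?_⟩
    · obtain ⟨B, hB⟩ := exists_ge hle hj.le
      exact ⟨B, le_sup_left.trans hB, le_sup_right.trans hB⟩
    · have h1 : X.1 ≤ A.1 ⊔ A'.1 := (le_iff_forall hle hj).2 fun B hB =>
        hXB B (le_sup_left.trans hB) (le_sup_right.trans hB)
      have h2 : A.1 ⊔ X.1 = A.1 ⊔ A'.1 := eq_of_le_of_finrank_le (sup_le le_sup_left h1)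
        (by rw [h]; exact lt_finrank_sup hX.symm)
      exact le_sup_right.trans (h2.ge.trans (sup_le hA hXB'))
  · rintro ⟨hne, ⟨B, hAB, hAB'⟩, h⟩
    obtain ⟨X, -, h2, h3⟩ := exists_neighbour_le_sup hne
    have h4 := h X h3.ne.symm (fun B hA hA' => h2.trans (sup_le hA hA'))
    have h5 : A'.1 ≤ A.1 ⊔ X.1 := (le_iff_forall (by rw [h3]; omega) hj).2 fun B hB =>
      h4 B (le_sup_left.trans hB) (le_sup_right.trans hB)
    refine le_antisymm ?_ (lt_finrank_sup hne)
    rw [← h3]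
    exact finrank_mono (sup_le le_sup_left h5)

theorem Neighbour.le_sup_iff {A A' : ProjSubspace L V i} (h : A.Neighbour A') (hij : i < j)
    (hj : j + 1 < finrank L V) {X : Submodule L V} : X ≤ A.1 ⊔ A'.1 ↔
      ∀ B : ProjSubspace L V j, A.1 ≤ B.1 → A'.1 ≤ B.1 → X ≤ B.1 := by
  rw [le_iff_forall (by rw [h]; omega) hj]
  simp only [sup_le_iff, and_imp]

/-- `X` meets the sum in dimension at most `i`, whereas `X ⊓ A` and `X ⊓ A'` already have dimension
`i`. So all three intersections coincide, and they fill `A ⊓ A'`. -/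
theorem inf_le_of_neighbour {A A' X : ProjSubspace L V i}
    (h : A.Neighbour A') (hX : ¬ X.1 ≤ A.1 ⊔ A'.1) (hA : X.Neighbour A) (hA' : X.Neighbour A') :
    A.1 ⊓ A'.1 = X.1 ⊓ (A.1 ⊔ A'.1) := by
  have h1 : finrank L (X.1 ⊓ (A.1 ⊔ A'.1) : Submodule L V) ≤ i := by
    by_contra hlt
    refine hX ?_
    have : X.1 ⊓ (A.1 ⊔ A'.1) = X.1 := eq_of_le_of_finrank_le inf_le_left (by rw [X.2]; omega)
    exact this ▸ inf_le_right
  rw [neighbour_iff_finrank_inf] at hA hA' h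
  have h2 : X.1 ⊓ A.1 = X.1 ⊓ (A.1 ⊔ A'.1) :=
    eq_of_le_of_finrank_le (inf_le_inf_left _ le_sup_left) (by omega)
  have h3 : X.1 ⊓ A'.1 = X.1 ⊓ (A.1 ⊔ A'.1) :=
    eq_of_le_of_finrank_le (inf_le_inf_left _ le_sup_right) (by omega)
  refine (eq_of_le_of_finrank_le (le_inf ?_ ?_) (by rw [← h2, h, hA])).symm
  · exact h2 ▸ inf_le_right
  · exact h3 ▸ inf_le_right

theorem neighbour_or_eq_of_le {C : Submodule L V} (hC : finrank L C = i)
    {A A' : ProjSubspace L V i} (hA : C ≤ A.1) (hA' : C ≤ A'.1) : A = A' ∨ A.Neighbour A' := by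
  by_cases h : A = A'
  · exact Or.inl h
  · refine Or.inr (neighbour_iff_finrank_inf.2 (le_antisymm ?_ ?_))
    · have := lt_finrank_sup h
      have := finrank_sup_add_finrank_inf A A'
      omega
    · have := finrank_mono (R := L) (le_inf hA hA')
      omega

/-- This describes the spaces through `A ⊓ A'` by neighbour relations and the span of `A` and `A'`.
The witness `Y` outside the span selects the clique of spaces with a common intersection, as opposed
to the clique inside a common `(i + 1)`-space. -/
theorem Neighbour.inf_le_iff {A A' X : ProjSubspace L V i} (h : A.Neighbour A')
    (hi : i + 2 < finrank L V) : A.1 ⊓ A'.1 ≤ X.1 ↔ ∃ Y : ProjSubspace L V i, Y.Neighbour A ∧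
      Y.Neighbour A' ∧ ¬ Y.1 ≤ A.1 ⊔ A'.1 ∧ (X = A ∨ X.Neighbour A) ∧ (X = A' ∨ X.Neighbour A') ∧
      (X = Y ∨ X.Neighbour Y) := by
  have hC := neighbour_iff_finrank_inf.1 h
  constructor
  · intro hX
    obtain ⟨y, hy⟩ := exists_notMem_of_finrank_lt (W := A.1 ⊔ A'.1) (by rw [h]; exact hi)
    have hyC : y ∉ A.1 ⊓ A'.1 := fun hm => hy (mem_sup_left hm.1)
    let Y : ProjSubspace L V i := ⟨A.1 ⊓ A'.1 ⊔ span L {y}, by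
      rw [finrank_sup_span_singleton hyC, hC]⟩
    have hCY : A.1 ⊓ A'.1 ≤ Y.1 := le_sup_left
    have hyY : y ∈ Y.1 := mem_sup_right (mem_span_singleton_self y)
    have hY : ¬ Y.1 ≤ A.1 ⊔ A'.1 := fun hle => hy (hle hyY)
    refine ⟨Y, (neighbour_or_eq_of_le hC hCY inf_le_left).resolve_left ?_,
      (neighbour_or_eq_of_le hC hCY inf_le_right).resolve_left ?_, hY,
      neighbour_or_eq_of_le hC hX inf_le_left, neighbour_or_eq_of_le hC hX inf_le_right,
      neighbour_or_eq_of_le hC hX hCY⟩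
    · intro h; exact hY (h ▸ le_sup_left)
    · intro h; exact hY (h ▸ le_sup_right)
  · rintro ⟨Y, hYA, hYA', hY, rfl | hXA, rfl | hXA', rfl | hXY⟩ <;>
      try first | exact inf_le_left | exact inf_le_right
    · rw [inf_le_of_neighbour h hY hYA hYA']
      exact inf_le_left
    · by_cases hX : X.1 ≤ A.1 ⊔ A'.1
      · have h1 := inf_le_of_neighbour h hY hYA hYA'
        have h2 : X.1 ⊓ Y.1 ≤ A.1 ⊓ A'.1 := by
          rw [h1]; exact le_inf inf_le_right (inf_le_left.trans hX)
        have h3 := neighbour_iff_finrank_inf.1 hXY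
        rw [← eq_of_le_of_finrank_le h2 (by omega)]
        exact inf_le_left
      · rw [inf_le_of_neighbour h hX hXA hXA']
        exact inf_le_left

theorem exists_neighbour_inf_eq (C : ProjSubspace L V i) (hi : i + 2 < finrank L V) :
    ∃ A A' : ProjSubspace L V (i + 1), A.Neighbour A' ∧ A.1 ⊓ A'.1 = C.1 := by
  obtain ⟨x, hx⟩ := exists_notMem_of_finrank_lt (W := C.1) (by rw [C.2]; omega)
  let A : ProjSubspace L V (i + 1) := ⟨C.1 ⊔ span L {x}, by
    rw [finrank_sup_span_singleton hx, C.2]⟩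
  obtain ⟨y, hy⟩ := exists_notMem_of_finrank_lt (W := A.1) (by rw [A.2]; omega)
  let A' : ProjSubspace L V (i + 1) := ⟨C.1 ⊔ span L {y}, by
    rw [finrank_sup_span_singleton fun hm => hy (mem_sup_left hm), C.2]⟩
  have hCA : C.1 ≤ A.1 := le_sup_left
  have hCA' : C.1 ≤ A'.1 := le_sup_left
  have h : A.Neighbour A' := (neighbour_or_eq_of_le C.2 hCA hCA').resolve_left fun h =>
    hy (h ▸ mem_sup_right (mem_span_singleton_self y))
  refine ⟨A, A', h, (eq_of_le_of_finrank_le (le_inf hCA hCA') ?_).symm⟩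
  rw [neighbour_iff_finrank_inf.1 h, C.2]

/-- For `i > 0`, an `i`-space containing two independent directions from a complement of `A` is too
far from `A` to be a neighbour. -/
theorem eq_zero_iff_forall_neighbour (hi : i + 2 < finrank L V) :
    i = 0 ↔ ∀ A A' : ProjSubspace L V i, A ≠ A' → A.Neighbour A' := by
  constructor
  · rintro rfl A A' h
    have := lt_finrank_sup h
    have := finrank_sup_add_finrank_inf A A'
    rw [Neighbour]
    omega
  · intro h
    by_contra hi0
    obtain ⟨A, -⟩ := exists_ge (L := L) (V := V) (W := ⊥) (j := i) (by simp) (by omega)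
    obtain ⟨K, hK⟩ := Submodule.exists_isCompl A.1
    have hKA := finrank_add_eq_of_isCompl hK
    rw [A.2] at hKA
    obtain ⟨K', -, h1, h2⟩ := exists_finrank_eq_between (bot_le : ⊥ ≤ K) (k := 2) (by simp)
      (by omega)
    obtain ⟨A', hA'⟩ := exists_ge (W := K') (j := i) (by omega) (by omega)
    have hdisj : A.1 ⊓ K' = ⊥ := (hK.disjoint.mono_right h1).eq_bot
    have h3 := finrank_sup_add_finrank_inf_eq A.1 K'
    rw [hdisj, finrank_bot, A.2, h2] at h3
    have h4 := finrank_mono (R := L) (sup_le_sup_left hA' A.1)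
    have hne : A ≠ A' := by
      rintro rfl
      rw [sup_idem, A.2] at h4
      omega
    have h5 := h A A' hne
    rw [Neighbour] at h5
    omega

end ProjSubspace

end Dimension

/-! ### Descent from `i`-spaces to points -/

section Incidence

variable {L V L' V' : Type*} [DivisionRing L] [AddCommGroup V] [Module L V]
  [DivisionRing L'] [AddCommGroup V'] [Module L' V']

namespace ProjSubspace

open Submodule

/-- The maps `φ` and `ψ` between the `i`-spaces and between the `j`-spaces of two projective spaces
preserve incidence in both directions. -/
def PreservesIncidence {i j i' j' : ℕ} (φ : ProjSubspace L V i ≃ ProjSubspace L' V' i')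
    (ψ : ProjSubspace L V j ≃ ProjSubspace L' V' j') : Prop :=
  ∀ A B, A.1 ≤ B.1 ↔ (φ A).1 ≤ (ψ B).1

namespace PreservesIncidence

variable {i j i' j' : ℕ}

theorem symm {φ : ProjSubspace L V i ≃ ProjSubspace L' V' i'}
    {ψ : ProjSubspace L V j ≃ ProjSubspace L' V' j'} (h : PreservesIncidence φ ψ) :
    PreservesIncidence φ.symm ψ.symm := fun A B => by
  rw [h, φ.apply_symm_apply, ψ.apply_symm_apply]

variable [FiniteDimensional L V] [FiniteDimensional L' V']

theorem neighbour_iff {φ : ProjSubspace L V i ≃ ProjSubspace L' V' i'}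
    {ψ : ProjSubspace L V j ≃ ProjSubspace L' V' j'} (h : PreservesIncidence φ ψ) (hij : i < j)
    (hj : j + 1 < finrank L V) (hij' : i' < j') (hj' : j' + 1 < finrank L' V')
    {A A' : ProjSubspace L V i} : A.Neighbour A' ↔ (φ A).Neighbour (φ A') := by
  rw [ProjSubspace.neighbour_iff hij hj, ProjSubspace.neighbour_iff hij' hj']
  simp only [φ.surjective.forall, ψ.surjective.forall, ψ.surjective.exists, ← h _ _,
    φ.injective.ne_iff]

theorem inf_le_iff {φ : ProjSubspace L V i ≃ ProjSubspace L' V' i'}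
    {ψ : ProjSubspace L V j ≃ ProjSubspace L' V' j'} (h : PreservesIncidence φ ψ) (hij : i < j)
    (hj : j + 1 < finrank L V) (hij' : i' < j') (hj' : j' + 1 < finrank L' V')
    {A A' X : ProjSubspace L V i} (hA : A.Neighbour A') :
    A.1 ⊓ A'.1 ≤ X.1 ↔ (φ A).1 ⊓ (φ A').1 ≤ (φ X).1 := by
  have hN : ∀ {A A' : ProjSubspace L V i}, A.Neighbour A' ↔ (φ A).Neighbour (φ A') :=
    h.neighbour_iff hij hj hij' hj'
  have hS : ∀ Y : ProjSubspace L V i, Y.1 ≤ A.1 ⊔ A'.1 ↔ (φ Y).1 ≤ (φ A).1 ⊔ (φ A').1 := by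
    intro Y
    rw [hA.le_sup_iff hij hj, (hN.1 hA).le_sup_iff hij' hj', ψ.surjective.forall]
    simp only [← h _ _]
  rw [hA.inf_le_iff (by omega), (hN.1 hA).inf_le_iff (by omega), φ.surjective.exists]
  simp only [← hN, ← hS, φ.injective.eq_iff]

omit [FiniteDimensional L' V'] in
theorem eq_of_forall_le_iff {C D : ProjSubspace L V i} (hi : i + 2 < finrank L V)
    (h : ∀ X : ProjSubspace L V (i + 1), C.1 ≤ X.1 → D.1 ≤ X.1) : D = C :=
  eq_of_le ((le_iff_forall (by rw [C.2]; omega) hi).2 h)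

/-- `C` is the intersection of two neighbours; `D` is the intersection of their images, and
`inf_le_iff` transports the spaces through it. -/
theorem exists_pred {φ : ProjSubspace L V (i + 1) ≃ ProjSubspace L' V' (i' + 1)}
    {ψ : ProjSubspace L V j ≃ ProjSubspace L' V' j'} (h : PreservesIncidence φ ψ) (hij : i + 1 < j)
    (hj : j + 1 < finrank L V) (hij' : i' + 1 < j') (hj' : j' + 1 < finrank L' V')
    (C : ProjSubspace L V i) : ∃ D : ProjSubspace L' V' i', ∀ X, C.1 ≤ X.1 ↔ D.1 ≤ (φ X).1 := by
  obtain ⟨A, A', hA, hC⟩ := exists_neighbour_inf_eq C (by omega)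
  have hD := neighbour_iff_finrank_inf.1 ((h.neighbour_iff hij hj hij' hj').1 hA)
  refine ⟨⟨_, hD⟩, fun X => ?_⟩
  rw [← hC]
  exact h.inf_le_iff hij hj hij' hj' hA

theorem exists_equiv_pred {φ : ProjSubspace L V (i + 1) ≃ ProjSubspace L' V' (i' + 1)}
    {ψ : ProjSubspace L V j ≃ ProjSubspace L' V' j'} (h : PreservesIncidence φ ψ) (hij : i + 1 < j)
    (hj : j + 1 < finrank L V) (hij' : i' + 1 < j') (hj' : j' + 1 < finrank L' V') :
    ∃ χ : ProjSubspace L V i ≃ ProjSubspace L' V' i', PreservesIncidence χ φ := by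
  -- The choices are forced, because a space is determined by the spaces one dimension higher that
  -- contain it. Hence `F` and `G` are mutually inverse.
  choose F hF using h.exists_pred hij hj hij' hj'
  choose G hG using h.symm.exists_pred hij' hj' hij hj
  refine ⟨⟨F, G, fun C => ?_, fun D => ?_⟩, hF⟩
  · refine eq_of_forall_le_iff (by omega) fun X hX => ?_
    have := (hG (F C) (φ X)).1 ((hF C X).1 hX)
    rwa [φ.symm_apply_apply] at this
  · refine eq_of_forall_le_iff (by omega) fun X hX => ?_
    have := (hF (G D) (φ.symm X)).1 ((hG D X).1 hX)
    rwa [φ.apply_symm_apply] at this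

theorem trans {k k' : ℕ} {φ : ProjSubspace L V i ≃ ProjSubspace L' V' i'}
    {ψ : ProjSubspace L V j ≃ ProjSubspace L' V' j'}
    {χ : ProjSubspace L V k ≃ ProjSubspace L' V' k'}
    (h : PreservesIncidence φ ψ) (h' : PreservesIncidence ψ χ) (hij : i ≤ j) (hjk : j ≤ k)
    (hij' : i' ≤ j') (hjk' : j' ≤ k') : PreservesIncidence φ χ := fun A B => by
  rw [le_iff_exists hij hjk, le_iff_exists hij' hjk', ψ.surjective.exists]
  simp only [h _ _, h' _ _]

/-- Both sides descend in parallel. By `eq_zero_iff_forall_neighbour` they reach points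
simultaneously, which is where `i = i'` comes from. -/
theorem exists_points {φ : ProjSubspace L V i ≃ ProjSubspace L' V' i'}
    {ψ : ProjSubspace L V j ≃ ProjSubspace L' V' j'} (h : PreservesIncidence φ ψ) (hij : i < j)
    (hj : j + 1 < finrank L V) (hij' : i' < j') (hj' : j' + 1 < finrank L' V') :
    i = i' ∧ ∃ χ : ProjSubspace L V 0 ≃ ProjSubspace L' V' 0,
      PreservesIncidence χ φ ∧ PreservesIncidence χ ψ := by
  induction i generalizing i' with
  | zero =>
    have h0 : i' = 0 := by
      rw [eq_zero_iff_forall_neighbour (L := L') (V := V') (by omega), φ.surjective.forall₂]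
      intro A A' hne
      exact (h.neighbour_iff hij hj hij' hj').1
        ((eq_zero_iff_forall_neighbour (by omega)).1 rfl A A' (mt (congrArg φ) hne))
    subst h0
    refine ⟨rfl, φ, fun A B => ⟨fun hAB => ?_, fun hAB => ?_⟩, h⟩
    · rw [eq_of_le hAB]
    · rw [φ.injective (eq_of_le hAB)]
  | succ i ih =>
    cases i' with
    | zero =>
      refine absurd (?_ : i + 1 = 0) (by omega)
      rw [eq_zero_iff_forall_neighbour (L := L) (V := V) (by omega), φ.symm.surjective.forall₂]
      intro A A' hne
      exact (h.symm.neighbour_iff hij' hj' hij hj).1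
        ((eq_zero_iff_forall_neighbour (by omega)).1 rfl A A' (mt (congrArg φ.symm) hne))
    | succ i' =>
      obtain ⟨χ, hχ⟩ := h.exists_equiv_pred hij hj hij' hj'
      have hχψ := hχ.trans h (by omega) hij.le (by omega) hij'.le
      obtain ⟨h0, π, hπ, hπψ⟩ := ih hχψ (by omega) (by omega)
      exact ⟨by rw [h0], π, hπ.trans hχ (by omega) (by omega) (by omega) (by omega), hπψ⟩

end PreservesIncidence

end ProjSubspace

end Incidence

/-! ### From point bijections to semilinear maps -/

section Semilinear

variable {L V L' V' : Type*} [DivisionRing L] [AddCommGroup V] [Module L V]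
  [DivisionRing L'] [AddCommGroup V'] [Module L' V']

open Submodule

theorem finrank_eq_of_image_eq {σ : L ≃+* L'} {f : V →ₛₗ[(σ : L →+* L')] V'}
    (hf : Function.Injective f) {U : Submodule L V} {U' : Submodule L' V'}
    (h : (U' : Set V') = f '' (U : Set V)) : finrank L' U' = finrank L U := by
  have hm : ∀ x : U, f x ∈ U' := fun x => by
    rw [← SetLike.mem_coe, h]
    exact ⟨x, x.2, rfl⟩
  let e : U →+ U' :=
    { toFun := fun x => ⟨f x, hm x⟩
      map_zero' := by ext; simp
      map_add' := fun x y => by ext; simp }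
  have he : Function.Bijective e := by
    refine ⟨fun x y hxy => Subtype.ext (hf (congrArg Subtype.val hxy)), fun y => ?_⟩
    obtain ⟨x, hx, hxy⟩ := h.le y.2
    exact ⟨⟨x, hx⟩, Subtype.ext hxy⟩
  have := lift_rank_eq_of_equiv_equiv σ (AddEquiv.ofBijective e he) σ.bijective
    (fun a x => Subtype.ext (f.map_smulₛₗ a (x : V)))
  have := congrArg Cardinal.toNat this
  rw [Cardinal.toNat_lift, Cardinal.toNat_lift] at this
  exact this.symm

theorem finrank_span_pair_le (x y : V) : finrank L (span L {x, y}) ≤ 2 := by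
  classical
  have := finrank_span_finset_le_card (R := L) ({x, y} : Finset V)
  rw [Finset.coe_pair] at this
  exact this.trans Finset.card_le_two

namespace ProjSubspace

theorem exists_span_singleton_eq (p : ProjSubspace L V 0) : ∃ v, span L {v} = p.1 := by
  obtain ⟨v, -, hv⟩ := finrank_eq_one_iff'.1 p.2
  refine ⟨v, le_antisymm ((span_singleton_le_iff_mem _ _).2 v.2) fun w hw => ?_⟩
  obtain ⟨c, hc⟩ := hv ⟨w, hw⟩
  exact mem_span_singleton.2 ⟨c, congrArg Subtype.val hc⟩

/-- The point spanned by a nonzero vector. -/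
def point (x : V) (hx : x ≠ 0) : ProjSubspace L V 0 := ⟨span L {x}, finrank_span_singleton hx⟩

namespace PreservesIncidence

variable {i j i' j' : ℕ}

theorem exists_map_span_eq (π : ProjSubspace L V 0 ≃ ProjSubspace L' V' 0) :
    ∃ g : V → V', g 0 = 0 ∧ ∀ x (hx : x ≠ 0), span L' {g x} = (π (point x hx)).1 := by
  classical
  choose u hu using exists_span_singleton_eq (L := L') (V := V')
  exact ⟨fun x => if hx : x = 0 then 0 else u (π (point x hx)), by simp,
    fun x hx => by simp [hx, hu]⟩

theorem mem_iff {π : ProjSubspace L V 0 ≃ ProjSubspace L' V' 0}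
    {φ : ProjSubspace L V i ≃ ProjSubspace L' V' i'} (h : PreservesIncidence π φ)
    {g : V → V'} (hg0 : g 0 = 0) (hg : ∀ x (hx : x ≠ 0), span L' {g x} = (π (point x hx)).1)
    (x : V) (A : ProjSubspace L V i) : x ∈ A.1 ↔ g x ∈ (φ A).1 := by
  rcases eq_or_ne x 0 with rfl | hx
  · simp [hg0]
  · have := h (point x hx) A
    rw [← hg] at this
    simpa only [point, span_singleton_le_iff_mem] using this

variable [FiniteDimensional L V] [FiniteDimensional L' V']

/-- As `0 < j`, the span of two vectors is the intersection of the `j`-spaces containing it, so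
collinearity is expressed by incidence with `j`-spaces. -/
theorem isCollineation {π : ProjSubspace L V 0 ≃ ProjSubspace L' V' 0}
    {ψ : ProjSubspace L V j ≃ ProjSubspace L' V' j'} (h : PreservesIncidence π ψ) (hj0 : 0 < j)
    (hj : j + 1 < finrank L V) (hj0' : 0 < j') (hj' : j' + 1 < finrank L' V')
    {g : V → V'} (hg0 : g 0 = 0) (hg : ∀ x (hx : x ≠ 0), span L' {g x} = (π (point x hx)).1) :
    IsCollineation L L' g where
  map_zero := hg0
  map_mem_span_pair x y z := by
    have h1 := finrank_span_pair_le (L := L) x y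
    have h2 := finrank_span_pair_le (L := L') (g x) (g y)
    rw [← span_singleton_le_iff_mem, ← span_singleton_le_iff_mem z,
      le_iff_forall (j := j') (by omega) hj', le_iff_forall (j := j) (by omega) hj,
      ψ.surjective.forall]
    simp only [span_insert, sup_le_iff, span_singleton_le_iff_mem, h.mem_iff hg0 hg]
  surj v := by
    rcases eq_or_ne v 0 with rfl | hv
    · exact ⟨0, zero_mem _⟩
    · obtain ⟨x, hx⟩ := exists_span_singleton_eq (π.symm (point v hv))
      have hx0 : x ≠ 0 := by
        rintro rfl
        have := (π.symm (point v hv)).2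
        rw [← hx, span_zero_singleton, finrank_bot] at this
        omega
      refine ⟨x, ?_⟩
      have h1 : point x hx0 = π.symm (point v hv) := Subtype.ext hx
      rw [hg x hx0, h1, π.apply_symm_apply]
      exact mem_span_singleton_self v

/-- Chow's theorem: a pair of bijections that preserves the incidence of `i`-spaces and `j`-spaces
is induced by a semilinear bijection. -/
theorem exists_semilinear {φ : ProjSubspace L V i ≃ ProjSubspace L' V' i'}
    {ψ : ProjSubspace L V j ≃ ProjSubspace L' V' j'} (h : PreservesIncidence φ ψ) (hij : i < j)
    (hj : j + 1 < finrank L V) (hij' : i' < j') (hj' : j' + 1 < finrank L' V') :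
    i = i' ∧ j = j' ∧ finrank L V = finrank L' V' ∧
      ∃ (σ : L ≃+* L') (f : V →ₛₗ[(σ : L →+* L')] V'), Function.Bijective f ∧
        (∀ A, ((φ A).1 : Set V') = f '' A.1) ∧ ∀ B, ((ψ B).1 : Set V') = f '' B.1 := by
  obtain ⟨hi, π, hφ, hψ⟩ := h.exists_points hij hj hij' hj'
  obtain ⟨g, hg0, hg⟩ := exists_map_span_eq π
  have hcol := hψ.isCollineation (by omega) hj (by omega) hj' hg0 hg
  obtain ⟨σ, f, hf, hfg⟩ := hcol.exists_semilinear fun x y =>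
    exists_notMem_of_finrank_lt (by have := finrank_span_pair_le (L := L) x y; omega)
  have key : ∀ {x : V} {U : Submodule L' V'}, f x ∈ U ↔ g x ∈ U := fun {x U} => by
    rw [← span_singleton_le_iff_mem, hfg, span_singleton_le_iff_mem]
  have himage : ∀ {k k' : ℕ} {χ : ProjSubspace L V k ≃ ProjSubspace L' V' k'},
      PreservesIncidence π χ → ∀ A, ((χ A).1 : Set V') = f '' A.1 := by
    intro k k' χ hχ A
    ext v
    obtain ⟨x, rfl⟩ := hf.2 v
    rw [hf.1.mem_set_image, SetLike.mem_coe, SetLike.mem_coe, hχ.mem_iff hg0 hg, key]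
  refine ⟨hi, ?_, ?_, σ, f, hf, himage hφ, himage hψ⟩
  · obtain ⟨B, -⟩ := exists_ge (L := L) (V := V) (W := ⊥) (j := j) (by simp) (by omega)
    have := finrank_eq_of_image_eq hf.1 (himage hψ B)
    rw [(ψ B).2, B.2] at this
    omega
  · have := finrank_eq_of_image_eq (U := ⊤) (U' := ⊤) hf.1
      (by rw [top_coe, top_coe, Set.image_univ, hf.2.range_eq])
    rw [finrank_top, finrank_top] at this
    exact this.symm

end PreservesIncidence

end ProjSubspace

end Semilinear

/-! ### Annihilators and the dual space over the opposite skew field -/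

section Duality

variable {L V : Type*} [DivisionRing L] [AddCommGroup V] [Module L V]

open Submodule

/-- The linear forms that vanish on a subspace, as a vector space over the opposite skew field. -/
def opAnnihilator (U : Submodule L V) : Submodule Lᵐᵒᵖ (V →ₗ[L] L) where
  carrier := {φ | ∀ u ∈ U, φ u = 0}
  add_mem' h h' u hu := by simp [h u hu, h' u hu]
  zero_mem' u _ := rfl
  smul_mem' a φ h u hu := by simp [h u hu]

/-- The common zero set of a space of linear forms. -/
def opCoannihilator (W : Submodule Lᵐᵒᵖ (V →ₗ[L] L)) : Submodule L V where
  carrier := {v | ∀ φ ∈ W, φ v = 0}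
  add_mem' h h' φ hφ := by simp [h φ hφ, h' φ hφ]
  zero_mem' φ _ := map_zero φ
  smul_mem' a v h φ hφ := by simp [h φ hφ]

theorem mem_opAnnihilator {U : Submodule L V} {φ : V →ₗ[L] L} :
    φ ∈ opAnnihilator U ↔ ∀ u ∈ U, φ u = 0 := Iff.rfl

theorem mem_opCoannihilator {W : Submodule Lᵐᵒᵖ (V →ₗ[L] L)} {v : V} :
    v ∈ opCoannihilator W ↔ ∀ φ ∈ W, φ v = 0 := Iff.rfl

theorem opCoannihilator_opAnnihilator (U : Submodule L V) :
    opCoannihilator (opAnnihilator U) = U := by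
  refine le_antisymm (fun v hv => ?_) fun v hv φ hφ => hφ v hv
  by_contra hvU
  obtain ⟨f, hf, hU⟩ := exists_le_ker_of_notMem hvU
  exact hf (hv f fun u hu => hU hu)

theorem opAnnihilator_le_iff {U U' : Submodule L V} :
    opAnnihilator U ≤ opAnnihilator U' ↔ U' ≤ U := by
  refine ⟨fun h => ?_, fun h φ hφ u hu => hφ u (h hu)⟩
  rw [← opCoannihilator_opAnnihilator U, ← opCoannihilator_opAnnihilator U']
  exact fun v hv φ hφ => hv φ (h hφ)

variable [FiniteDimensional L V]

/-- The coordinates of a linear form. -/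
noncomputable def opDualEquivFun :
    (V →ₗ[L] L) ≃ₗ[Lᵐᵒᵖ] (Fin (finrank L V) → Lᵐᵒᵖ) :=
  ((finBasis L V).constr Lᵐᵒᵖ).symm.trans
    -- Values of forms lie in `L` with scalars acting by right multiplication; `op` turns this into
    -- the left regular module of `Lᵐᵒᵖ`.
    (LinearEquiv.piCongrRight fun _ => MulOpposite.opLinearEquiv Lᵐᵒᵖ)

instance finiteDimensional_opDual : FiniteDimensional Lᵐᵒᵖ (V →ₗ[L] L) :=
  Module.Finite.equiv opDualEquivFun.symm

theorem finrank_opDual : finrank Lᵐᵒᵖ (V →ₗ[L] L) = finrank L V := by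
  rw [(opDualEquivFun (L := L) (V := V)).finrank_eq, finrank_fin_fun]

/-- Rank and nullity for the restriction of linear forms to `U`, which is surjective with kernel the
annihilator. -/
theorem finrank_opAnnihilator (U : Submodule L V) :
    finrank L U + finrank Lᵐᵒᵖ (opAnnihilator U) = finrank L V := by
  let r : (V →ₗ[L] L) →ₗ[Lᵐᵒᵖ] (U →ₗ[L] L) :=
    { toFun := fun φ => φ.comp U.subtype
      map_add' := fun _ _ => rfl
      map_smul' := fun _ _ => rfl }
  have hr : LinearMap.range r = ⊤ := LinearMap.range_eq_top.2 fun φ => φ.exists_extend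
  have hk : LinearMap.ker r = opAnnihilator U := by
    ext φ
    rw [LinearMap.mem_ker, mem_opAnnihilator, LinearMap.ext_iff]
    exact ⟨fun h u hu => h ⟨u, hu⟩, fun h u => h u u.2⟩
  have := LinearMap.finrank_range_add_finrank_ker r
  rwa [hr, hk, finrank_top, finrank_opDual, finrank_opDual] at this

/-- The common zeros of `W` include the common kernel of a basis of `W`, which has codimension at
most `dim W`. This bound suffices for the double annihilator identity. -/
theorem finrank_le_opCoannihilator (W : Submodule Lᵐᵒᵖ (V →ₗ[L] L)) :
    finrank L V ≤ finrank L (opCoannihilator W) + finrank Lᵐᵒᵖ W := by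
  have : Module.Free Lᵐᵒᵖ W := Module.Free.of_divisionRing Lᵐᵒᵖ W
  let b := finBasis Lᵐᵒᵖ W
  let r : V →ₗ[L] (Fin (finrank Lᵐᵒᵖ W) → L) := LinearMap.pi fun k => (b k : V →ₗ[L] L)
  have hk : LinearMap.ker r ≤ opCoannihilator W := by
    intro v hv φ hφ
    have h1 : ∀ k, (b k : V →ₗ[L] L) v = 0 := fun k => congrFun hv k
    have h2 := congrArg (fun w : W => (w : V →ₗ[L] L) v) (b.sum_repr ⟨φ, hφ⟩)
    simp only [AddSubmonoidClass.coe_finsetSum, SetLike.val_smul, LinearMap.sum_apply,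
      LinearMap.smul_apply, h1, smul_zero, Finset.sum_const_zero] at h2
    exact h2.symm
  have h1 := LinearMap.finrank_range_add_finrank_ker r
  have h2 := finrank_le (LinearMap.range r)
  rw [finrank_fin_fun] at h2
  have h3 := finrank_mono (R := L) hk
  omega

theorem opAnnihilator_opCoannihilator (W : Submodule Lᵐᵒᵖ (V →ₗ[L] L)) :
    opAnnihilator (opCoannihilator W) = W := by
  refine (eq_of_le_of_finrank_le (fun φ hφ v hv => hv φ hφ) ?_).symm
  have := finrank_opAnnihilator (opCoannihilator W)
  have := finrank_le_opCoannihilator W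
  omega

namespace ProjSubspace

/-- The `d`-spaces correspond to the `e`-spaces of the dual space, if `d + e + 2` is the dimension
of the vector space. -/
def opAnnihilatorEquiv {d e : ℕ} (h : d + 1 + (e + 1) = finrank L V) :
    ProjSubspace L V d ≃ ProjSubspace Lᵐᵒᵖ (V →ₗ[L] L) e where
  toFun U := ⟨opAnnihilator U.1, by
    have := finrank_opAnnihilator U.1
    rw [U.2] at this
    omega⟩
  invFun W := ⟨opCoannihilator W.1, by
    have := finrank_opAnnihilator (opCoannihilator W.1)
    rw [opAnnihilator_opCoannihilator, W.2] at this
    omega⟩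
  left_inv U := Subtype.ext (opCoannihilator_opAnnihilator U.1)
  right_inv W := Subtype.ext (opAnnihilator_opCoannihilator W.1)

variable {L' V' : Type*} [DivisionRing L'] [AddCommGroup V'] [Module L' V']
  [FiniteDimensional L' V'] {i j i' j' : ℕ}

/-- A pair of bijections that reverses the incidence of `i`-spaces and `j`-spaces is induced by a
semilinear bijection to the dual space. -/
theorem exists_duality {φ : ProjSubspace L V i ≃ ProjSubspace L' V' j'}
    {ψ : ProjSubspace L V j ≃ ProjSubspace L' V' i'} (h : ∀ A B, A.1 ≤ B.1 ↔ (ψ B).1 ≤ (φ A).1)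
    (hij : i < j) (hj : j + 1 < finrank L V) (hij' : i' < j') (hj' : j' + 1 < finrank L' V') :
    i + j' + 2 = finrank L' V' ∧ j + i' + 2 = finrank L' V' ∧ finrank L V = finrank L' V' ∧
      ∃ (σ : L ≃+* L'ᵐᵒᵖ) (f : V →ₛₗ[(σ : L →+* L'ᵐᵒᵖ)] (V' →ₗ[L'] L')), Function.Bijective f ∧
        (∀ A, ((φ A).1 : Set V') = {v | ∀ u ∈ A.1, f u v = 0}) ∧
        ∀ B, ((ψ B).1 : Set V') = {v | ∀ u ∈ B.1, f u v = 0} := by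
  obtain ⟨e, he⟩ : ∃ e, j' + 1 + (e + 1) = finrank L' V' := ⟨finrank L' V' - j' - 2, by omega⟩
  obtain ⟨d, hd⟩ : ∃ d, i' + 1 + (d + 1) = finrank L' V' := ⟨finrank L' V' - i' - 2, by omega⟩
  have hinc : PreservesIncidence (φ.trans (opAnnihilatorEquiv he))
      (ψ.trans (opAnnihilatorEquiv hd)) := fun A B => (h A B).trans opAnnihilator_le_iff.symm
  obtain ⟨h1, h2, h3, σ, f, hf, hφ, hψ⟩ :=
    hinc.exists_semilinear hij hj (by omega) (by rw [finrank_opDual]; omega)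
  rw [finrank_opDual] at h3
  have key : ∀ {U : Submodule L V} {U' : Submodule L' V'},
      (opAnnihilator U' : Set (V' →ₗ[L'] L')) = f '' U →
      (U' : Set V') = {v | ∀ u ∈ U, f u v = 0} := by
    intro U U' hU
    ext v
    rw [SetLike.mem_coe, ← opCoannihilator_opAnnihilator U', mem_opCoannihilator]
    change (∀ φ ∈ (opAnnihilator U' : Set (V' →ₗ[L'] L')), φ v = 0) ↔ _
    rw [hU, Set.forall_mem_image]
    rfl
  exact ⟨by omega, by omega, h3, σ, f, hf, fun A => key (hφ A), fun B => key (hψ B)⟩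

end ProjSubspace

end Duality

/-! ### Graph isomorphisms and the biparts -/

section Graph

variable {L V L' V' : Type*} [DivisionRing L] [AddCommGroup V] [Module L V]
  [DivisionRing L'] [AddCommGroup V'] [Module L' V']

theorem Equiv.exists_of_sum {α β γ δ : Type*} (e : α ⊕ β ≃ γ ⊕ δ)
    (h₁ : ∀ a, ∃ c, e (Sum.inl a) = Sum.inl c) (h₂ : ∀ b, ∃ d, e (Sum.inr b) = Sum.inr d) :
    ∃ (φ : α ≃ γ) (ψ : β ≃ δ), (∀ a, e (Sum.inl a) = Sum.inl (φ a)) ∧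
      ∀ b, e (Sum.inr b) = Sum.inr (ψ b) := by
  choose φ hφ using h₁
  choose ψ hψ using h₂
  refine ⟨Equiv.ofBijective φ ⟨fun a a' h => ?_, fun c => ?_⟩,
    Equiv.ofBijective ψ ⟨fun b b' h => ?_, fun d => ?_⟩, hφ, hψ⟩
  · exact Sum.inl_injective (e.injective (by rw [hφ, hφ, h]))
  · obtain ⟨a | b, h⟩ := e.surjective (Sum.inl c)
    · exact ⟨a, Sum.inl_injective (by rw [← hφ, h])⟩
    · simp [hψ] at h
  · exact Sum.inr_injective (e.injective (by rw [hψ, hψ, h]))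
  · obtain ⟨a | b, h⟩ := e.surjective (Sum.inr d)
    · simp [hφ] at h
    · exact ⟨b, Sum.inr_injective (by rw [← hψ, h])⟩

/-- This is connectedness, stated for invariants `c`: `A` moves to a neighbour that meets `A'` in a
larger space, and the two neighbours share a `j`-space. -/
theorem ProjSubspace.eq_of_forall_common [FiniteDimensional L V] {i j : ℕ} (hij : i < j)
    (hj : j + 1 < finrank L V) {α : Type*} (c : ProjSubspace L V i → α)
    (hc : ∀ (A A' : ProjSubspace L V i) (B : ProjSubspace L V j), A.1 ≤ B.1 → A'.1 ≤ B.1 →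
      c A = c A') (A A' : ProjSubspace L V i) : c A = c A' := by
  induction hm : i + 1 - finrank L (A.1 ⊓ A'.1 : Submodule L V) using Nat.strong_induction_on
    generalizing A with
  | _ m ih =>
    by_cases hA : A = A'
    · rw [hA]
    obtain ⟨X, h1, -, h3⟩ := exists_neighbour_le_sup hA
    obtain ⟨B, hB⟩ := exists_ge (W := A.1 ⊔ X.1) (j := j) (by rw [h3]; omega) hj.le
    rw [hc A X B (le_sup_left.trans hB) (le_sup_right.trans hB)]
    refine ih _ ?_ X rfl
    have h4 := Submodule.finrank_lt_finrank_of_lt h1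
    have h5 := Submodule.finrank_mono (R := L) (inf_le_left : X.1 ⊓ A'.1 ≤ X.1)
    rw [X.2] at h5
    omega

variable {i j i' j' : ℕ}

theorem bipGraph_adj_iff [FiniteDimensional L V] {A : ProjSubspace L V i}
    {B : ProjSubspace L V j} :
    (bipGraph L V i j i).Adj (Sum.inl A) (Sum.inr B) ↔ A.1 ≤ B.1 := by
  change finrank L (A.1 ⊓ B.1 : Submodule L V) = i + 1 ↔ _
  constructor
  · intro h
    have : A.1 ⊓ B.1 = A.1 := Submodule.eq_of_le_of_finrank_le inf_le_left (by rw [A.2, h])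
    exact this ▸ inf_le_right
  · intro h
    rw [inf_eq_left.2 h, A.2]

theorem isLeft_eq_not_of_bipGraph_adj {k : ℕ} {x y : BipVertex L V i j}
    (h : (bipGraph L V i j k).Adj x y) : x.isLeft = !y.isLeft := by
  rcases x with x | x <;> rcases y with y | y <;> first | rfl | exact h.elim

variable [FiniteDimensional L V] [FiniteDimensional L' V']

/-- An isomorphism of the bipartite graphs either preserves or interchanges the biparts. -/
theorem bipGraph_iso_cases (hij : i < j) (hj : j + 1 < finrank L V)
    (Φ : bipGraph L V i j i ≃g bipGraph L' V' i' j' i') :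
    (∃ (φ : ProjSubspace L V i ≃ ProjSubspace L' V' i')
        (ψ : ProjSubspace L V j ≃ ProjSubspace L' V' j'),
        ProjSubspace.PreservesIncidence φ ψ ∧ (∀ A, Φ (Sum.inl A) = Sum.inl (φ A)) ∧
          ∀ B, Φ (Sum.inr B) = Sum.inr (ψ B)) ∨
      ∃ (φ : ProjSubspace L V i ≃ ProjSubspace L' V' j')
        (ψ : ProjSubspace L V j ≃ ProjSubspace L' V' i'),
        (∀ A B, A.1 ≤ B.1 ↔ (ψ B).1 ≤ (φ A).1) ∧ (∀ A, Φ (Sum.inl A) = Sum.inr (φ A)) ∧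
          ∀ B, Φ (Sum.inr B) = Sum.inl (ψ B) := by
  have hadj : ∀ {A : ProjSubspace L V i} {B : ProjSubspace L V j}, A.1 ≤ B.1 →
      (Φ (Sum.inl A)).isLeft = !(Φ (Sum.inr B)).isLeft := fun h =>
    isLeft_eq_not_of_bipGraph_adj (Φ.map_adj_iff.2 (bipGraph_adj_iff.2 h))
  -- Two `i`-spaces in a common `j`-space have images on the side opposite to its image, so the side
  -- is the same for all `i`-spaces.
  have hconst := ProjSubspace.eq_of_forall_common hij hj (fun A => (Φ (Sum.inl A)).isLeft)
    fun A A' B h h' => by simp only [hadj h, hadj h']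
  have hsub : ∀ B : ProjSubspace L V j, ∃ A : ProjSubspace L V i, A.1 ≤ B.1 := fun B => by
    obtain ⟨A, -, h1, h2⟩ := Submodule.exists_finrank_eq_between (bot_le : ⊥ ≤ B.1) (k := i + 1)
      (by simp) (by rw [B.2]; omega)
    exact ⟨⟨A, h2⟩, h1⟩
  obtain ⟨A₀, -⟩ := ProjSubspace.exists_ge (L := L) (V := V) (W := ⊥) (j := i) (by simp) (by omega)
  cases h₀ : (Φ (Sum.inl A₀)).isLeft with
  | true =>
    have h₁ : ∀ A, (Φ (Sum.inl A)).isLeft = true := fun A => (hconst A A₀).trans h₀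
    obtain ⟨φ, ψ, hφ, hψ⟩ := Equiv.exists_of_sum Φ.toEquiv (fun A => Sum.isLeft_iff.1 (h₁ A))
      fun B => by
        obtain ⟨A, hA⟩ := hsub B
        have := hadj hA
        rw [h₁] at this
        exact Sum.isRight_iff.1 (by rw [← Sum.not_isLeft]; exact by simpa using this.symm)
    refine Or.inl ⟨φ, ψ, fun A B => ?_, hφ, hψ⟩
    rw [← bipGraph_adj_iff, ← bipGraph_adj_iff, ← hφ, ← hψ]
    exact Φ.map_adj_iff.symm
  | false =>
    have h₁ : ∀ A, (Φ (Sum.inl A)).isLeft = false := fun A => (hconst A A₀).trans h₀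
    obtain ⟨φ, ψ, hφ, hψ⟩ := Equiv.exists_of_sum (Φ.toEquiv.trans (Equiv.sumComm _ _))
      (fun A => by
        obtain ⟨c, hc⟩ := Sum.isRight_iff.1 (by rw [← Sum.not_isLeft, h₁ A]; exact Bool.false_ne_true)
        exact ⟨c, congrArg Sum.swap hc⟩)
      fun B => by
        obtain ⟨A, hA⟩ := hsub B
        have := hadj hA
        rw [h₁] at this
        obtain ⟨c, hc⟩ := Sum.isLeft_iff.1 (by simpa using this.symm)
        exact ⟨c, congrArg Sum.swap hc⟩
    have hφ' : ∀ A, Φ (Sum.inl A) = Sum.inr (φ A) := fun A => by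
      simpa using congrArg Sum.swap (hφ A)
    have hψ' : ∀ B, Φ (Sum.inr B) = Sum.inl (ψ B) := fun B => by
      simpa using congrArg Sum.swap (hψ B)
    refine Or.inr ⟨φ, ψ, fun A B => ?_, hφ', hψ'⟩
    rw [← bipGraph_adj_iff, ← bipGraph_adj_iff, SimpleGraph.adj_comm (bipGraph L' V' i' j' i'),
      ← hφ', ← hψ']
    exact Φ.map_adj_iff.symm

end Graph

/-! ### The main theorem -/

theorem mainTheorem5 {L V : Type*} [DivisionRing L] [AddCommGroup V] [Module L V]
    (n i j : ℕ) (hV : Module.finrank L V = n + 1) (hij : i < j) (hn : i + j + 1 ≤ n) :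
    -- the graph determines `i`, `j`, `n` and `L` (up to passing to the opposite if `i + j = n - 1`)
    (∀ {L' V' : Type*} [DivisionRing L'] [AddCommGroup V'] [Module L' V'] (n' i' j' : ℕ),
      Module.finrank L' V' = n' + 1 → i' < j' → i' + j' + 1 ≤ n' →
      Nonempty (bipGraph L V i j i ≃g bipGraph L' V' i' j' i') →
        i = i' ∧ j = j' ∧ n = n' ∧
          (Nonempty (L ≃+* L') ∨ (i + j + 1 = n ∧ Nonempty (L ≃+* L'ᵐᵒᵖ)))) ∧
    -- every automorphism is induced by a semilinear permutation, or a duality if `i + j = n - 1`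
    (∀ Φ : bipGraph L V i j i ≃g bipGraph L V i j i,
      InducedBySemilinear Φ ∨ (i + j + 1 = n ∧ InducedByDuality Φ)) := by
  have : FiniteDimensional L V := Module.finite_of_finrank_pos (by omega)
  constructor
  · intro L' V' _ _ _ n' i' j' hV' hij' hn' ⟨Φ⟩
    have : FiniteDimensional L' V' := Module.finite_of_finrank_pos (by omega)
    rcases bipGraph_iso_cases hij (by omega) Φ with ⟨φ, ψ, h, -, -⟩ | ⟨φ, ψ, h, -, -⟩
    · obtain ⟨h1, h2, h3, σ, -⟩ := h.exists_semilinear hij (by omega) hij' (by omega)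
      exact ⟨h1, h2, by omega, Or.inl ⟨σ⟩⟩
    · obtain ⟨h1, h2, h3, σ, -⟩ :=
        ProjSubspace.exists_duality h hij (by omega) hij' (by omega)
      -- Here `i + j'` and `j + i'` both equal `n - 1`, so `i + j` and `i' + j'` add up to `2 * (n -
      -- 1)`. Each is at most `n - 1`, hence both are equal to it, and then `i = i'` and `j = j'`.
      exact ⟨by omega, by omega, by omega, Or.inr ⟨by omega, ⟨σ⟩⟩⟩
  · intro Φ
    rcases bipGraph_iso_cases hij (by omega) Φ with ⟨φ, ψ, h, hφ, hψ⟩ | ⟨φ, ψ, h, hφ, hψ⟩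
    · obtain ⟨-, -, -, σ, f, hf, hA, hB⟩ := h.exists_semilinear hij (by omega) hij (by omega)
      refine Or.inl ⟨σ, f, hf, ?_⟩
      rintro (A | B)
      · rw [hφ]; exact hA A
      · rw [hψ]; exact hB B
    · obtain ⟨h1, h2, -, σ, f, hf, hA, hB⟩ :=
        ProjSubspace.exists_duality h hij (by omega) hij (by omega)
      refine Or.inr ⟨by omega, σ, f, hf, ?_⟩
      rintro (A | B)
      · rw [hφ]; exact hA A
      · rw [hψ]; exact hB B
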